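/- Let $H$ be a real Hilbert space, $A:H\to 2^H$ maximal monotone, and $B:H\to H$ $\beta$-cocoercive for some $\beta>0$, i.e. $\langle x-y,Bx-By\rangle\ge\beta\|Bx-By\|^2$ for all $x,y\in H$. Suppose that $\Omega:=\mathrm{zer}(A+B)=\{x\in H: 0\in Ax+Bx\}\neq\emptyset$. Let $\alpha>0$, let $(\eta_k)_{k\ge 0}$ be a summable sequence in $[0,+\infty)$, and let $U_k$ ($k\ge 0$) be bounded self-adjoint operators on $H$ with $U_k\succeq\alpha I$ in the Loewner order (written $U_k\in\mathcal P_\alpha(H)$), such that $$\mu:=\sup_{k}\|U_k\|<+\infty\quad\text{and}\quad (1+\eta_k)U_{k+1}\succeq U_k\quad\text{for all }k\ge 0.$$ Let $\gamma_k\in\left(0,\frac{2\beta}{\|U_k\|}\right)$ and $\lambda_k\in\left(0,\frac1{\alpha_k}\right)$, where $\alpha_k=\frac{2\beta}{4\beta-\gamma_k\|U_k\|}$ (if $H=\{0\}$, a quotient with denominator $\|U_k\|=0$ or $\mu=0$ is read as $+\infty$). Let $(a_k)$ and $(b_k)$ be sequences in $H$ with $\sum_{k}\lambda_k\|a_k\|<+\infty$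 and $\sum_{k}\lambda_k\|b_k\|<+\infty$. Let $x_0\in H$ and, for $k\ge 0$, $$y_k=x_k-\gamma_kU_k(Bx_k+b_k),\qquad x_{k+1}=x_k+\lambda_k\bigl(J_{\gamma_kU_kA}(y_k)+a_k-x_k\bigr),$$ where $J_{\gamma_kU_kA}=(I+\gamma_kU_kA)^{-1}$ is the (everywhere defined, single-valued) resolvent. Write $\|x\|_W=\sqrt{\langle Wx,x\rangle}$. Then: (i) For every $x^*\in\Omega$, $\lim_{k\to\infty}\|x_k-x^*\|_{U_k^{-1}}$ exists in $\mathbb R$. Suppose that there are $\underline\lambda>0$ and $\tau>0$, with $\tau<\frac1{\alpha_k}-\underline\lambda$ for all $k$, such that $\underline\lambda\le\lambda_k\le\frac1{\alpha_k}-\tau$ for all $k$. Then: (ii) $\lim_{k\to\infty}\|x_k-J_{\gamma_kU_kA}(x_k-\gamma_kU_kBx_k)\|=0$. Suppose in addition that there is $\underline\gamma>0$ with $\underline\gamma\le\gamma_k$ for all $k$. Then: (iii) $(x_k)$ converges weakly to a point of $\Omega$. Suppose further that there is $\varepsilon\in(0,2\beta-\mu\underline\gamma)$ with $\gamma_k\le\frac{2\beta-\varepsilon}{\mu}$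 for all $k$. Then: (iv) $Bx_k\to Bx^*$ strongly as $k\to\infty$, for every $x^*\in\Omega$. -/

import Mathlib

open Filter Topology
open scoped InnerProductSpace Pointwise

namespace VMFB

noncomputable section

variable {H : Type*} [NormedAddCommGroup H] [InnerProductSpace ℝ H]

/-- The graph of a set-valued operator `A : H → 2^H`. -/
def gra (A : H → Set H) : Set (H × H) := {p | p.2 ∈ A p.1}

/-- The zeros of a set-valued operator. -/
def zer (A : H → Set H) : Set H := {x | 0 ∈ A x}

/-- Monotone set-valued operators. -/
def IsMonotoneOp (A : H → Set H) : Prop :=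
  ∀ x y u v : H, (x, u) ∈ gra A → (y, v) ∈ gra A → 0 ≤ ⟪x - y, u - v⟫_ℝ

/-- Maximal monotone operators: the graph is not strictly contained in the graph of any
monotone operator. -/
def IsMaximalMonotone (A : H → Set H) : Prop :=
  IsMonotoneOp A ∧ ∀ A' : H → Set H, IsMonotoneOp A' → ¬ gra A ⊂ gra A'

/-- `β`-cocoercive single-valued operators (used with `β > 0`). -/
def IsCocoercive (β : ℝ) (B : H → H) : Prop :=
  ∀ x y : H, β * ‖B x - B y‖ ^ 2 ≤ ⟪x - y, B x - B y⟫_ℝ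

/-- The set-valued operator `A + B`, where `B` is single-valued. -/
def addSingle (A : H → Set H) (B : H → H) : H → Set H := fun x => A x + {B x}

/-- The set-valued operator `γ U A`, that is `x ↦ {γ U u | u ∈ A x}`. -/
def scaledOp (γ : ℝ) (U : H →L[ℝ] H) (A : H → Set H) : H → Set H :=
  fun x => (fun u => γ • U u) '' A x

/-- The inverse `(I + A)⁻¹` of the set-valued operator `I + A`, as a set-valued operator. -/
def resolventSet (A : H → Set H) : H → Set H := fun y => {p | y ∈ ({p} : Set H) + A p}

/-- The resolvent `J_A = (I + A)⁻¹` as a point-valued map: `resolvent A y` is the point of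
`(I + A)⁻¹ y`. (For the operators considered here, `(I + A)⁻¹ y` is a singleton
for every `y`, by Minty's theorem; an arbitrary value is taken where it is empty.) -/
def resolvent (A : H → Set H) (y : H) : H := Classical.epsilon fun p => p ∈ resolventSet A y

/-- `𝒫_α(H)`: self-adjoint bounded operators `U` with `U ⪰ α I` in the Loewner order. -/
def metricClass [CompleteSpace H] (α : ℝ) : Set (H →L[ℝ] H) :=
  {U | IsSelfAdjoint U ∧ α • (1 : H →L[ℝ] H) ≤ U}

/-- The norm `‖x‖_W = √⟨W x, x⟩` attached to a positive operator `W`. -/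
def opNorm (W : H →L[ℝ] H) (x : H) : ℝ := √⟪W x, x⟫_ℝ

/-- The constant `2β / (4β - γ ‖U‖)`. -/
def avgConst (β γ : ℝ) (U : H →L[ℝ] H) : ℝ := 2 * β / (4 * β - γ * ‖U‖)

/-- Weak convergence of a sequence in `H`. -/
def WeaklyConverges (x : ℕ → H) (z : H) : Prop :=
  Tendsto (fun k => toWeakSpace ℝ H (x k)) atTop (𝓝 (toWeakSpace ℝ H z))

end

end VMFB

namespace VMFB

variable {H : Type*} [NormedAddCommGroup H] [InnerProductSpace ℝ H]

/-! ### Positive operators -/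

/-! In the metric of `U_k⁻¹`, the exact step `p_k = J(x_k - γ_k U_k B x_k)` satisfies a descent
inequality towards every zero `x*`. Monotonicity of `A` and cocoercivity of `B` give
`opNorm_sq_forwardBackward_le`. Young's inequality and relaxation turn it into a decrease of `‖x_k -
x*‖²` by `λ_k(1/α_k - λ_k)‖x_k - p_k‖²` (`opNorm_sq_relaxed_le`). The resolvent is nonexpansive in
this metric, so the errors add only a summable term, and changing metric costs a factor `1 + η_k`.
Such a quasi-Fejér sequence has convergent distances and vanishing decrease, which gives (i) and
(ii).

For (iii), `x_k - p_k → 0` makes the residual of `-B p_k ∈ A p_k` vanish, so weak cluster points are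
zeros by demiclosedness (`neg_mem_of_tendsto`). Opial's argument then gives uniqueness of the
cluster point, because the metrics converge pointwise after rescaling. For (iv), the term in `‖B x_k
- B x*‖²` given up to Young's inequality is kept instead.

That the resolvents are defined everywhere is Minty's theorem, proved by minimizing the Fitzpatrick
function plus a quadratic form. -/

theorem inner_map_comm_of_isPositive {T : H →L[ℝ] H} (hT : T.IsPositive) (x y : H) :
    ⟪T x, y⟫_ℝ = ⟪T y, x⟫_ℝ := by
  rw [hT.inner_left_eq_inner_right, real_inner_comm]

/-- Positivity of the form at `x - ‖T‖⁻¹ T x`, expanded. This bound turns convergence of quadratic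
forms into norm convergence of vectors. -/
theorem norm_map_sq_le_of_isPositive {T : H →L[ℝ] H} (hT : T.IsPositive) (x : H) :
    ‖T x‖ ^ 2 ≤ ‖T‖ * ⟪T x, x⟫_ℝ := by
  rcases (norm_nonneg T).eq_or_lt with h0 | h0
  · have : T = 0 := norm_eq_zero.1 h0.symm
    simp [this]
  have h1 := hT.inner_nonneg_left (x - ‖T‖⁻¹ • T x)
  have h2 : ⟪T (T x), T x⟫_ℝ ≤ ‖T‖ * ‖T x‖ ^ 2 := by
    refine (real_inner_le_norm _ _).trans ?_
    nlinarith [T.le_opNorm (T x), norm_nonneg (T x)]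
  have h3 : ⟪T (T x), x⟫_ℝ = ‖T x‖ ^ 2 := by
    rw [inner_map_comm_of_isPositive hT, real_inner_self_eq_norm_sq]
  simp only [map_sub, map_smul, inner_sub_left, inner_sub_right, real_inner_smul_left,
    real_inner_smul_right, h3, real_inner_self_eq_norm_sq] at h1
  have h4 : ‖T‖⁻¹ * (‖T‖⁻¹ * ⟪T (T x), T x⟫_ℝ) ≤ ‖T‖⁻¹ * ‖T x‖ ^ 2 := by
    refine mul_le_mul_of_nonneg_left ?_ (inv_nonneg.2 h0.le)
    rwa [inv_mul_le_iff₀ h0]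
  have h5 : ‖T‖⁻¹ * ‖T x‖ ^ 2 ≤ ⟪T x, x⟫_ℝ := by linarith
  rwa [inv_mul_le_iff₀ h0] at h5

theorem opNorm_nonneg (W : H →L[ℝ] H) (x : H) : 0 ≤ opNorm W x := Real.sqrt_nonneg _

theorem opNorm_sq {W : H →L[ℝ] H} (hW : W.IsPositive) (x : H) :
    opNorm W x ^ 2 = ⟪W x, x⟫_ℝ := Real.sq_sqrt (hW.inner_nonneg_left x)

theorem inner_map_le_opNorm_mul {W : H →L[ℝ] H} (hW : W.IsPositive) (x y : H) :
    ⟪W x, y⟫_ℝ ≤ opNorm W x * opNorm W y := by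
  have h := discrim_le_zero (a := ⟪W x, x⟫_ℝ) (b := 2 * ⟪W x, y⟫_ℝ) (c := ⟪W y, y⟫_ℝ) fun t => by
    have := hW.inner_nonneg_left (t • x + y)
    simp only [map_add, map_smul, inner_add_left, inner_add_right, real_inner_smul_left,
      real_inner_smul_right, inner_map_comm_of_isPositive hW y x] at this
    linarith
  rw [discrim, ← opNorm_sq hW x, ← opNorm_sq hW y] at h
  refine abs_le_of_sq_le_sq' ?_ (mul_nonneg (opNorm_nonneg W x) (opNorm_nonneg W y)) |>.2
  linarith

theorem opNorm_add_le {W : H →L[ℝ] H} (hW : W.IsPositive) (x y : H) :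
    opNorm W (x + y) ≤ opNorm W x + opNorm W y := by
  refine abs_le_of_sq_le_sq' ?_ (add_nonneg (opNorm_nonneg W x) (opNorm_nonneg W y)) |>.2
  rw [opNorm_sq hW, add_sq, opNorm_sq hW, opNorm_sq hW]
  simp only [map_add, inner_add_left, inner_add_right, inner_map_comm_of_isPositive hW y x]
  linarith [inner_map_le_opNorm_mul hW x y]

theorem opNorm_smul {W : H →L[ℝ] H} {c : ℝ} (hc : 0 ≤ c) (x : H) :
    opNorm W (c • x) = c * opNorm W x := by
  rw [opNorm, opNorm, map_smul, real_inner_smul_left, real_inner_smul_right, ← mul_assoc,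
    Real.sqrt_mul (mul_self_nonneg c), Real.sqrt_mul_self hc]

/-! ### The class `𝒫_α(H)` and inverses -/

section metricClass

variable [CompleteSpace H] {α : ℝ} {U : H →L[ℝ] H}

theorem metricClass.le_inner (hU : U ∈ metricClass (H := H) α) (x : H) :
    α * ‖x‖ ^ 2 ≤ ⟪U x, x⟫_ℝ := by
  have h := ((ContinuousLinearMap.le_def _ _).1 hU.2).inner_nonneg_left x
  simp only [sub_apply, smul_apply,
    one_apply_eq_self, inner_sub_left, real_inner_smul_left,
    real_inner_self_eq_norm_sq] at h
  linarith

theorem metricClass.isPositive (hα : 0 < α) (hU : U ∈ metricClass (H := H) α) :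
    U.IsPositive := by
  refine (ContinuousLinearMap.isPositive_iff' U).2 ⟨hU.1, fun x => ?_⟩
  exact (by positivity : 0 ≤ α * ‖x‖ ^ 2).trans (metricClass.le_inner hU x)

theorem metricClass.isInvertible (hα : 0 < α) (hU : U ∈ metricClass (H := H) α) :
    U.IsInvertible := by
  have h : IsUnit U := by
    refine ContinuousLinearMap.isUnit_of_forall_le_norm_inner_map U (c := ⟨α, hα.le⟩) hα
      fun x => ?_
    have h := metricClass.le_inner hU x
    rw [Real.norm_eq_abs]
    change ‖x‖ ^ 2 * α ≤ _
    rw [mul_comm]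
    exact h.trans (le_abs_self _)
  obtain ⟨u, hu⟩ := h
  exact ⟨ContinuousLinearEquiv.ofUnit u, hu⟩

theorem metricClass.inverse_apply_self (hα : 0 < α) (hU : U ∈ metricClass (H := H) α) (x : H) :
    U.inverse (U x) = x :=
  (metricClass.isInvertible hα hU).inverse_apply_eq.2 rfl

theorem metricClass.apply_inverse_self (hα : 0 < α) (hU : U ∈ metricClass (H := H) α) (x : H) :
    U (U.inverse x) = x :=
  ((metricClass.isInvertible hα hU).inverse_apply_eq.1 rfl).symm

theorem metricClass.inverse_isPositive (hα : 0 < α) (hU : U ∈ metricClass (H := H) α) :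
    U.inverse.IsPositive := by
  have hs := metricClass.isPositive hα hU
  refine (ContinuousLinearMap.isPositive_iff _).2 ⟨fun x y => ?_, fun x => ?_⟩
  · have := hs.inner_left_eq_inner_right (U.inverse x) (U.inverse y)
    rw [metricClass.apply_inverse_self hα hU, metricClass.apply_inverse_self hα hU] at this
    exact this.symm
  · have := hs.inner_nonneg_right (U.inverse x)
    rwa [metricClass.apply_inverse_self hα hU] at this

theorem metricClass.norm_sq_le (hα : 0 < α) (hU : U ∈ metricClass (H := H) α) (x : H) :
    ‖x‖ ^ 2 ≤ ‖U‖ * ⟪U.inverse x, x⟫_ℝ := by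
  have h := norm_map_sq_le_of_isPositive (metricClass.isPositive hα hU) (U.inverse x)
  rwa [metricClass.apply_inverse_self hα hU, real_inner_comm] at h

theorem metricClass.norm_inverse_le (hα : 0 < α) (hU : U ∈ metricClass (H := H) α) (x : H) :
    α * ‖U.inverse x‖ ≤ ‖x‖ := by
  have h := metricClass.le_inner hU (U.inverse x)
  rw [metricClass.apply_inverse_self hα hU] at h
  rcases (norm_nonneg (U.inverse x)).eq_or_lt with h0 | h0
  · rw [← h0]; simp
  · have := real_inner_le_norm x (U.inverse x)
    refine le_of_mul_le_mul_right ?_ h0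
    linarith

theorem metricClass.inner_inverse_le (hα : 0 < α) (hU : U ∈ metricClass (H := H) α) (x : H) :
    α * ⟪U.inverse x, x⟫_ℝ ≤ ‖x‖ ^ 2 := by
  have h1 := metricClass.norm_inverse_le hα hU x
  have h2 := real_inner_le_norm (U.inverse x) x
  nlinarith [norm_nonneg x]

theorem metricClass.opNorm_inverse_le (hα : 0 < α) (hU : U ∈ metricClass (H := H) α) (x : H) :
    opNorm U.inverse x ≤ ‖x‖ / √α := by
  rw [opNorm, le_div_iff₀ (Real.sqrt_pos.2 hα), ← Real.sqrt_mul' _ hα.le]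
  refine Real.sqrt_le_iff.2 ⟨norm_nonneg x, ?_⟩
  linarith [metricClass.inner_inverse_le hα hU x]

/-- Inversion reverses the Loewner order. With `z = U'⁻¹ x`, combine `⟪U z, z⟫ ≤ c ⟪x, z⟫` with
positivity of `U` at `c U⁻¹ x - z`. -/
theorem metricClass.inner_inverse_le_of_le {U' : H →L[ℝ] H} {c : ℝ} (hα : 0 < α) (hc : 0 < c)
    (hU : U ∈ metricClass (H := H) α) (hU' : U' ∈ metricClass (H := H) α) (h : U ≤ c • U')
    (x : H) : ⟪U'.inverse x, x⟫_ℝ ≤ c * ⟪U.inverse x, x⟫_ℝ := by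
  set z := U'.inverse x with hz
  have h1 := ((ContinuousLinearMap.le_def _ _).1 h).inner_nonneg_left z
  have hz' : U' z = x := metricClass.apply_inverse_self hα hU' x
  simp only [sub_apply, smul_apply, inner_sub_left,
    real_inner_smul_left, hz'] at h1
  have hP := metricClass.isPositive hα hU
  have h2 := hP.inner_nonneg_left (c • U.inverse x - z)
  simp only [map_sub, map_smul, metricClass.apply_inverse_self hα hU, inner_sub_left,
    inner_sub_right, real_inner_smul_left, real_inner_smul_right] at h2
  have h3 : ⟪U z, U.inverse x⟫_ℝ = ⟪x, z⟫_ℝ := by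
    rw [inner_map_comm_of_isPositive hP, metricClass.apply_inverse_self hα hU]
  rw [h3, real_inner_comm (U.inverse x) x] at h2
  rw [real_inner_comm x z]
  have h4 : 0 ≤ c * (c * ⟪U.inverse x, x⟫_ℝ - ⟪x, z⟫_ℝ) := by linarith
  linarith [nonneg_of_mul_nonneg_right h4 hc]

theorem smul_one_mem_metricClass (c : ℝ) : c • (1 : H →L[ℝ] H) ∈ metricClass (H := H) c :=
  ⟨by
    rw [ContinuousLinearMap.isSelfAdjoint_iff_isSymmetric]
    intro x y
    simp [real_inner_smul_left, real_inner_smul_right], le_rfl⟩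

end metricClass

/-! ### Sequences -/

theorem one_le_prod_one_add {η : ℕ → ℝ} (hη0 : ∀ k, 0 ≤ η k) (k : ℕ) :
    1 ≤ ∏ i ∈ Finset.range k, (1 + η i) := by
  induction k with
  | zero => simp
  | succ k ih =>
    rw [Finset.prod_range_succ]
    exact one_le_mul_of_one_le_of_one_le ih (by linarith [hη0 k])

theorem exists_tendsto_prod_one_add {η : ℕ → ℝ} (hη0 : ∀ k, 0 ≤ η k) (hη : Summable η) :
    ∃ l : ℝ, Tendsto (fun k => ∏ i ∈ Finset.range k, (1 + η i)) atTop (𝓝 l) := by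
  have hm : Multipliable fun i => 1 + η i :=
    multipliable_one_add_of_summable (by simpa [abs_of_nonneg, hη0] using hη)
  exact ⟨_, hm.hasProd.tendsto_prod_nat⟩

theorem exists_tendsto_of_le_one_add_mul {s δ η : ℕ → ℝ} (hs : ∀ k, 0 ≤ s k)
    (hδ0 : ∀ k, 0 ≤ δ k) (hδ : Summable δ) (hη0 : ∀ k, 0 ≤ η k) (hη : Summable η)
    (h : ∀ k, s (k + 1) ≤ (1 + η k) * (s k + δ k)) : ∃ l : ℝ, Tendsto s atTop (𝓝 l) := by
  obtain ⟨P, hP⟩ := exists_tendsto_prod_one_add hη0 hη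
  set p : ℕ → ℝ := fun k => ∏ i ∈ Finset.range k, (1 + η i) with hp
  have hp1 : ∀ k, 1 ≤ p k := one_le_prod_one_add hη0
  have hpos : ∀ k, 0 < p k := fun k => one_pos.trans_le (hp1 k)
  have hsucc : ∀ k, p (k + 1) = p k * (1 + η k) := fun k => Finset.prod_range_succ _ _
  -- Dividing by the convergent product absorbs the factors `1 + η k`; subtracting the partial sums
  -- absorbs the errors. What is left is antitone and bounded below.
  set t : ℕ → ℝ := fun k => s k / p k - ∑ i ∈ Finset.range k, δ i with ht
  have hanti : Antitone t := by
    refine antitone_nat_of_succ_le fun k => ?_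
    have h1 : s (k + 1) / p (k + 1) ≤ s k / p k + δ k := by
      rw [div_le_iff₀ (hpos _), hsucc]
      have h2 : (s k / p k + δ k) * (p k * (1 + η k)) = (1 + η k) * (s k + δ k * p k) := by
        have := (hpos k).ne'
        field_simp
      rw [h2]
      refine (h k).trans (mul_le_mul_of_nonneg_left ?_ (by linarith [hη0 k]))
      linarith [le_mul_of_one_le_right (hδ0 k) (hp1 k)]
    simp only [ht, Finset.sum_range_succ]
    linarith
  have hbdd : BddBelow (Set.range t) := by
    refine ⟨-∑' i, δ i, ?_⟩
    rintro _ ⟨k, rfl⟩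
    have := hδ.sum_le_tsum (Finset.range k) fun i _ => hδ0 i
    have := div_nonneg (hs k) (hpos k).le
    simp only [ht]
    linarith
  have hlim := (tendsto_atTop_ciInf hanti hbdd).add hδ.hasSum.tendsto_sum_nat
  refine ⟨_, (hlim.mul hP).congr fun k => ?_⟩
  simp only [ht, sub_add_cancel]
  exact div_mul_cancel₀ _ (hpos k).ne'

/-- A sequence of positive operators that decreases pointwise (as quadratic forms) converges
pointwise. -/
theorem exists_tendsto_of_antitone_isPositive [CompleteSpace H] {W : ℕ → H →L[ℝ] H} {C : ℝ}
    (hW : ∀ k, (W k).IsPositive) (hC : ∀ k, ‖W k‖ ≤ C)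
    (hanti : ∀ k x, ⟪W (k + 1) x, x⟫_ℝ ≤ ⟪W k x, x⟫_ℝ) (x : H) :
    ∃ v : H, Tendsto (fun k => W k x) atTop (𝓝 v) := by
  have hmono : ∀ z, Antitone fun k => ⟪W k z, z⟫_ℝ := fun z =>
    antitone_nat_of_succ_le fun k => hanti k z
  have hlim : CauchySeq fun k => ⟪W k x, x⟫_ℝ :=
    (tendsto_atTop_ciInf (hmono x)
      ⟨0, by rintro _ ⟨k, rfl⟩; exact (hW k).inner_nonneg_left x⟩).cauchySeq
  have hC0 : 0 ≤ C := (norm_nonneg _).trans (hC 0)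
  -- `W m - W n` is positive with norm at most `2 * C`, so the Cauchy property of the forms passes
  -- to the vectors.
  have key : ∀ m n, m ≤ n →
      ‖W m x - W n x‖ ^ 2 ≤ 2 * C * (⟪W m x, x⟫_ℝ - ⟪W n x, x⟫_ℝ) := by
    intro m n hmn
    have hp : (W m - W n).IsPositive := by
      refine (ContinuousLinearMap.isPositive_iff _).2 ⟨fun y z => ?_, fun z => ?_⟩
      · have h1 := (hW m).inner_left_eq_inner_right y z
        have h2 := (hW n).inner_left_eq_inner_right y z
        simp only [ContinuousLinearMap.coe_coe, sub_apply, inner_sub_left,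
          inner_sub_right, h1, h2]
      · rw [sub_apply, inner_sub_left]
        linarith [hmono z hmn]
    have h := norm_map_sq_le_of_isPositive hp x
    rw [sub_apply, inner_sub_left] at h
    refine h.trans (mul_le_mul_of_nonneg_right ?_ (by linarith [hmono x hmn]))
    linarith [norm_sub_le (W m) (W n), hC m, hC n]
  refine cauchySeq_tendsto_of_complete (Metric.cauchySeq_iff'.2 fun ε hε => ?_)
  obtain ⟨N, hN⟩ := Metric.cauchySeq_iff'.1 hlim (ε ^ 2 / (2 * C + 1)) (by positivity)
  refine ⟨N, fun n hn => ?_⟩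
  have h1 := hN n hn
  rw [Real.dist_eq, abs_sub_comm, lt_div_iff₀ (by positivity)] at h1
  have h2 := key N n hn
  have h3 := le_abs_self (⟪W N x, x⟫_ℝ - ⟪W n x, x⟫_ℝ)
  have h4 := abs_nonneg (⟪W N x, x⟫_ℝ - ⟪W n x, x⟫_ℝ)
  rw [dist_comm, dist_eq_norm]
  refine lt_of_pow_lt_pow_left₀ 2 hε.le ?_
  nlinarith

/-! ### Weak convergence -/

theorem weaklyConverges_of_tendsto_inner [CompleteSpace H] {x : ℕ → H} {z : H}
    (h : ∀ v, Tendsto (fun k => ⟪x k, v⟫_ℝ) atTop (𝓝 ⟪z, v⟫_ℝ)) : WeaklyConverges x z := by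
  refine (Topology.IsInducing.induced _).tendsto_nhds_iff.2 (tendsto_pi_nhds.2 fun f => ?_)
  have key : ∀ w : H, f w = ⟪w, (InnerProductSpace.toDual ℝ H).symm f⟫_ℝ := fun w => by
    rw [real_inner_comm, InnerProductSpace.toDual_symm_apply]
  have h' := h ((InnerProductSpace.toDual ℝ H).symm f)
  simp only [← key] at h'
  exact h'

/-- Banach–Alaoglu through the Riesz isomorphism; ultrafilters play the role of weakly convergent
subsequences. -/
theorem exists_forall_tendsto_inner_of_bounded [CompleteSpace H] {ι : Type*} (F : Ultrafilter ι)
    {x : ι → H} {R : ℝ} (hx : ∀ k, ‖x k‖ ≤ R) :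
    ∃ z : H, ∀ v, Tendsto (fun k => ⟪x k, v⟫_ℝ) F (𝓝 ⟪z, v⟫_ℝ) := by
  have hc := WeakDual.isCompact_closedBall (𝕜 := ℝ) (E := H) 0 R
  obtain ⟨φ, -, hφ⟩ := hc.ultrafilter_le_nhds
    (F.map fun k => StrongDual.toWeakDual (InnerProductSpace.toDual ℝ H (x k))) (by
      rw [le_principal_iff, Ultrafilter.mem_coe, Ultrafilter.mem_map]
      refine Filter.univ_mem' fun k => ?_
      simpa using hx k)
  refine ⟨(InnerProductSpace.toDual ℝ H).symm (WeakDual.toStrongDual φ), fun v => ?_⟩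
  rw [InnerProductSpace.toDual_symm_apply]
  exact tendsto_iff_forall_eval_tendsto_topDualPairing.1 hφ v

end VMFB

namespace VMFB

/-! ### Minty's theorem -/

/-- A supremum of continuous affine functions `f i + d i`, perturbed by half a coercive quadratic
form, attains its minimum; this is the optimality condition at the minimizer. -/
theorem exists_isMin_sup_affine_add_quadratic {E : Type*} [NormedAddCommGroup E]
    [NormedSpace ℝ E] [CompleteSpace E] (Q : E →L[ℝ] E →L[ℝ] ℝ) (hs : ∀ x y, Q x y = Q y x)
    {c : ℝ} (hc : 0 < c) (hQ : ∀ x, c * ‖x‖ ^ 2 ≤ Q x x) {ι : Type*} [hι : Nonempty ι]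
    (f : ι → E →L[ℝ] ℝ) (d : ι → ℝ) (hne : ∃ z t, ∀ i, f i z + d i ≤ t) :
    ∃ z₀ t₀, (∀ i, f i z₀ + d i ≤ t₀) ∧
      ∀ z t, (∀ i, f i z + d i ≤ t) → t₀ - Q z₀ (z - z₀) ≤ t := by
  set S : Set (E × ℝ) := {p | ∀ i, f i p.1 + d i ≤ p.2} with hS
  set g : E × ℝ → ℝ := fun p => p.2 + Q p.1 p.1 / 2 with hg
  have hSne : S.Nonempty := let ⟨z, t, h⟩ := hne; ⟨(z, t), h⟩
  have hbdd : BddBelow (g '' S) := by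
    obtain ⟨i⟩ := hι
    refine ⟨d i - ‖f i‖ ^ 2 / (2 * c), ?_⟩
    rintro _ ⟨⟨z, t⟩, hz, rfl⟩
    have h1 : f i z + d i ≤ t := hz i
    have h2 := neg_le_of_abs_le ((f i).le_opNorm z)
    have h3 := hQ z
    have h4 : c * ‖z‖ ^ 2 / 2 - ‖f i‖ * ‖z‖ + ‖f i‖ ^ 2 / (2 * c) =
        (c * ‖z‖ - ‖f i‖) ^ 2 / (2 * c) := by
      field_simp
      ring
    have h5 : 0 ≤ (c * ‖z‖ - ‖f i‖) ^ 2 / (2 * c) := by positivity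
    simp only [hg]
    linarith
  set m := sInf (g '' S) with hm
  have hmle : ∀ p ∈ S, m ≤ g p := fun p hp => csInf_le hbdd ⟨p, hp, rfl⟩
  have hex : ∀ n : ℕ, ∃ p ∈ S, g p < m + 1 / ((n : ℝ) + 1) := fun n => by
    obtain ⟨_, ⟨p, hp, rfl⟩, h⟩ := exists_lt_of_csInf_lt (hSne.image g)
      (lt_add_of_pos_right m (Nat.one_div_pos_of_nat (n := n)))
    exact ⟨p, hp, h⟩
  choose p hpS hp using hex
  have hconv : ∀ q ∈ S, ∀ r ∈ S, ∀ s : ℝ, 0 ≤ s → s ≤ 1 →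
      ((q.1 + s • (r.1 - q.1), q.2 + s * (r.2 - q.2)) : E × ℝ) ∈ S := by
    intro q hq r hr s hs0 hs1 i
    have h1 := mul_le_mul_of_nonneg_left (hq i) (sub_nonneg.2 hs1)
    have h2 := mul_le_mul_of_nonneg_left (hr i) hs0
    simp only [map_add, map_smul, map_sub, smul_eq_mul]
    linarith
  -- Strong convexity: at the midpoint `g` lies below the average of its two values by `Q d d / 8`,
  -- with `d` the difference, yet it is at least `m`.
  have hclose : ∀ i j, c * ‖(p i).1 - (p j).1‖ ^ 2 ≤
      4 * (1 / ((i : ℝ) + 1) + 1 / ((j : ℝ) + 1)) := by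
    intro i j
    have h1 := hmle _ (hconv _ (hpS j) _ (hpS i) (1 / 2) (by norm_num) (by norm_num))
    have h2 := hQ ((p i).1 - (p j).1)
    have h3 := hp i
    have h4 := hp j
    simp only [hg, map_add, map_sub, map_smul, add_apply, sub_apply, smul_apply, smul_eq_mul,
      hs (p i).1 (p j).1] at h1 h2 h3 h4
    linarith
  have hcau : CauchySeq fun n => (p n).1 := by
    refine Metric.cauchySeq_iff'.2 fun ε hε => ?_
    obtain ⟨N, hN⟩ := exists_nat_one_div_lt (show 0 < c * ε ^ 2 / 8 by positivity)
    refine ⟨N, fun n hn => ?_⟩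
    rw [dist_eq_norm]
    refine lt_of_pow_lt_pow_left₀ 2 hε.le (lt_of_mul_lt_mul_left ?_ hc.le)
    have h1 := hclose n N
    have h2 : 1 / ((n : ℝ) + 1) ≤ 1 / ((N : ℝ) + 1) := Nat.one_div_le_one_div hn
    linarith
  obtain ⟨z₀, hz₀⟩ := cauchySeq_tendsto_of_complete hcau
  have hQlim : Tendsto (fun n => Q (p n).1 (p n).1) atTop (𝓝 (Q z₀ z₀)) := by
    have : Continuous fun z => Q z z := by fun_prop
    exact (this.tendsto z₀).comp hz₀
  have hfeas : ∀ i, f i z₀ + d i ≤ m - Q z₀ z₀ / 2 := by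
    intro i
    have h1 : Tendsto (fun n => f i (p n).1 + d i + Q (p n).1 (p n).1 / 2) atTop
        (𝓝 (f i z₀ + d i + Q z₀ z₀ / 2)) :=
      ((((f i).continuous.tendsto z₀).comp hz₀).add_const _).add (hQlim.div_const 2)
    have h2 : Tendsto (fun n : ℕ => m + 1 / ((n : ℝ) + 1)) atTop (𝓝 (m + 0)) :=
      tendsto_const_nhds.add tendsto_one_div_add_atTop_nhds_zero_nat
    have h3 := le_of_tendsto_of_tendsto' h1 h2 fun n => by
      have h4 := hp n
      have h5 := hpS n i
      simp only [hg] at h4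
      linarith
    linarith
  refine ⟨z₀, m - Q z₀ z₀ / 2, hfeas, fun z t hz => ?_⟩
  -- Compare the minimizer with points of the segment towards `(z, t)` and divide by `s`; letting `s
  -- → 0` removes the quadratic term.
  have hopt : ∀ s : ℝ, 0 < s → s ≤ 1 →
      0 ≤ (t - (m - Q z₀ z₀ / 2) + Q z₀ (z - z₀)) + s * (Q (z - z₀) (z - z₀) / 2) := by
    intro s hs0 hs1
    have h1 := hmle _ (hconv (z₀, m - Q z₀ z₀ / 2) hfeas (z, t) hz s hs0.le hs1)
    refine nonneg_of_mul_nonneg_right ?_ hs0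
    simp only [hg, map_add, map_sub, map_smul, add_apply, sub_apply, smul_apply, smul_eq_mul,
      hs z z₀] at h1 ⊢
    linarith
  have hlim : Tendsto (fun s : ℝ => (t - (m - Q z₀ z₀ / 2) + Q z₀ (z - z₀)) +
      s * (Q (z - z₀) (z - z₀) / 2)) (𝓝[>] 0)
      (𝓝 ((t - (m - Q z₀ z₀ / 2) + Q z₀ (z - z₀)) + 0 * (Q (z - z₀) (z - z₀) / 2))) := by
    refine Tendsto.mono_left ?_ nhdsWithin_le_nhds
    exact (Continuous.tendsto (by fun_prop) 0)
  have h0 := ge_of_tendsto hlim (by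
    filter_upwards [Ioc_mem_nhdsGT (zero_lt_one (α := ℝ))] with s hs
    exact hopt s hs.1 hs.2)
  linarith

variable {H : Type*} [NormedAddCommGroup H] [InnerProductSpace ℝ H]

/-- Minty's theorem for a maximal monotone graph `G` and a coercive self-adjoint operator `W` with
coercive right inverse `Z`: the range of `W + G` contains `0`. -/
theorem exists_neg_map_mem_of_maximalMonotone [CompleteSpace H] {G : Set (H × H)}
    (hne : G.Nonempty) (hmono : ∀ p ∈ G, ∀ q ∈ G, 0 ≤ ⟪p.1 - q.1, p.2 - q.2⟫_ℝ)
    (hmax : ∀ p : H × H, (∀ q ∈ G, 0 ≤ ⟪p.1 - q.1, p.2 - q.2⟫_ℝ) → p ∈ G)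
    {W Z : H →L[ℝ] H} (hW : W.IsPositive) (hZ : Z.IsPositive) (hWZ : ∀ x, W (Z x) = x)
    {c : ℝ} (hc : 0 < c) (hcW : ∀ x, c * ‖x‖ ^ 2 ≤ ⟪W x, x⟫_ℝ)
    (hcZ : ∀ x, c * ‖x‖ ^ 2 ≤ ⟪Z x, x⟫_ℝ) : ∃ x, (x, -W x) ∈ G := by
  have : Nonempty G := hne.to_subtype
  let fs := ContinuousLinearMap.fst ℝ H H
  let sn := ContinuousLinearMap.snd ℝ H H
  let Q : (H × H) →L[ℝ] (H × H) →L[ℝ] ℝ :=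
    (innerSL ℝ).bilinearComp (W ∘L fs) fs + (innerSL ℝ).bilinearComp (Z ∘L sn) sn
  have hQ : ∀ p q, Q p q = ⟪W p.1, q.1⟫_ℝ + ⟪Z p.2, q.2⟫_ℝ := fun p q => rfl
  -- With the constants `-⟪p.1.1, p.1.2⟫`, the supremum of these affine functions is the Fitzpatrick
  -- function of `G`.
  let f : G → (H × H) →L[ℝ] ℝ := fun p => innerSL ℝ p.1.2 ∘L fs + innerSL ℝ p.1.1 ∘L sn
  have hf : ∀ p q, f p q = ⟪p.1.2, q.1⟫_ℝ + ⟪p.1.1, q.2⟫_ℝ := fun p q => rfl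
  have hfeas : ∀ q ∈ G, ∀ p : G, f p q + -⟪p.1.1, p.1.2⟫_ℝ ≤ ⟪q.1, q.2⟫_ℝ := fun q hq p => by
    have h := hmono q hq p p.2
    simp only [inner_sub_left, inner_sub_right] at h
    rw [hf, real_inner_comm]
    linarith
  obtain ⟨⟨x₀, u₀⟩, t₀, h1, h2⟩ := exists_isMin_sup_affine_add_quadratic Q
    (fun p q => by
      rw [hQ, hQ, inner_map_comm_of_isPositive hW, inner_map_comm_of_isPositive hZ])
    hc (fun p => by
      rw [hQ]
      have e1 := hcW p.1
      have e2 := hcZ p.2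
      have e3 : ‖p‖ ^ 2 ≤ ‖p.1‖ ^ 2 + ‖p.2‖ ^ 2 := by
        rw [Prod.norm_def]
        rcases max_choice ‖p.1‖ ‖p.2‖ with h | h <;> rw [h] <;>
          nlinarith [sq_nonneg ‖p.1‖, sq_nonneg ‖p.2‖]
      nlinarith)
    f (fun p => -⟪p.1.1, p.1.2⟫_ℝ) (let ⟨q, hq⟩ := hne; ⟨q, _, hfeas q hq⟩)
  -- The Fitzpatrick function dominates the duality pairing: otherwise `(x₀, u₀)` is monotonically
  -- related to `G`, hence in `G`, and its own constraint is violated.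
  have ht : ⟪x₀, u₀⟫_ℝ ≤ t₀ := by
    by_contra! hlt
    have hmem : (x₀, u₀) ∈ G := hmax _ fun q hq => by
      have h := h1 ⟨q, hq⟩
      rw [hf] at h
      simp only [inner_sub_left, inner_sub_right]
      rw [real_inner_comm] at h
      linarith
    have h := h1 ⟨_, hmem⟩
    rw [hf] at h
    simp only [real_inner_comm] at h hlt
    linarith
  have e1 : ⟪W x₀, Z u₀⟫_ℝ = ⟪x₀, u₀⟫_ℝ := by
    rw [inner_map_comm_of_isPositive hW, hWZ, real_inner_comm]
  have e2 : ⟪W (x₀ + Z u₀), x₀ + Z u₀⟫_ℝ =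
      ⟪W x₀, x₀⟫_ℝ + ⟪Z u₀, u₀⟫_ℝ + 2 * ⟪x₀, u₀⟫_ℝ := by
    simp only [map_add, hWZ, inner_add_left, inner_add_right, e1]
    rw [real_inner_comm x₀ u₀, real_inner_comm (Z u₀) u₀]
    ring
  -- Optimality tested on `G`. By maximality `(-Z u₀, -W x₀)` lies in `G`; taking it as `q` then
  -- forces `x₀ = -Z u₀`.
  have key : ∀ q ∈ G, ⟪W (x₀ + Z u₀), x₀ + Z u₀⟫_ℝ ≤ ⟪-Z u₀ - q.1, -W x₀ - q.2⟫_ℝ := by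
    intro q hq
    have h := h2 q _ (hfeas q hq)
    rw [hQ] at h
    rw [e2]
    simp only [Prod.fst_sub, Prod.snd_sub, inner_sub_left, inner_sub_right, inner_neg_left,
      inner_neg_right] at h ⊢
    rw [real_inner_comm (W x₀) (Z u₀), e1, real_inner_comm (W x₀) q.1]
    linarith
  have hmem : (-Z u₀, -W x₀) ∈ G := hmax _ fun q hq =>
    (hW.inner_nonneg_left _).trans (key q hq)
  have h3 := key _ hmem
  simp only [sub_self, inner_zero_left] at h3
  have h4 := hcW (x₀ + Z u₀)
  have h5 : ‖x₀ + Z u₀‖ ^ 2 = 0 := by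
    refine le_antisymm ?_ (sq_nonneg _)
    by_contra! h
    nlinarith
  have h6 : x₀ = -Z u₀ := eq_neg_of_add_eq_zero_left (by simpa using h5)
  exact ⟨x₀, by rwa [← h6] at hmem⟩

theorem IsMaximalMonotone.mem_of_forall_inner_nonneg {A : H → Set H} (hA : IsMaximalMonotone A)
    {x u : H} (h : ∀ y v, v ∈ A y → 0 ≤ ⟪x - y, u - v⟫_ℝ) : u ∈ A x := by
  by_contra hu
  refine hA.2 (fun z => A z ∪ {w | z = x ∧ w = u}) ?_ ?_
  · rintro y z v w (hv | ⟨rfl, rfl⟩) (hw | ⟨rfl, rfl⟩)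
    · exact hA.1 y z v w hv hw
    · have := h y v hv
      rwa [← neg_sub y, ← neg_sub v, inner_neg_neg] at this
    · exact h z w hw
    · simp
  · refine ⟨fun p hp => Or.inl hp, fun hsub => hu ?_⟩
    exact hsub (show ((x, u) : H × H) ∈ _ from Or.inr ⟨rfl, rfl⟩)

/-- Minty's theorem with `W = (γU)⁻¹`, applied to the graph of `A` translated by `-W y` in the
second variable. -/
theorem IsMaximalMonotone.exists_smul_inverse_sub_mem [CompleteSpace H] {A : H → Set H}
    (hA : IsMaximalMonotone A) (hne : (gra A).Nonempty) {α γ : ℝ} (hα : 0 < α) (hγ : 0 < γ)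
    {U : H →L[ℝ] H} (hU : U ∈ metricClass (H := H) α) (y : H) :
    ∃ p, γ⁻¹ • U.inverse (y - p) ∈ A p := by
  set W : H →L[ℝ] H := γ⁻¹ • U.inverse with hWdef
  set Z : H →L[ℝ] H := γ • U with hZdef
  have hγ' : 0 < γ⁻¹ := inv_pos.2 hγ
  have hN : 0 < ‖U‖ + 1 := by positivity
  have hG : ∃ p, (p, -W p) ∈ {q : H × H | q.2 + W y ∈ A q.1} := by
    refine exists_neg_map_mem_of_maximalMonotone (W := W) (Z := Z)
      (c := min (γ⁻¹ * (‖U‖ + 1)⁻¹) (γ * α)) ?_ ?_ ?_ ?_ ?_ ?_ (by positivity) ?_ ?_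
    · obtain ⟨⟨v, w⟩, h⟩ := hne
      have h' : w ∈ A v := h
      exact ⟨(v, w - W y), by simpa using h'⟩
    · intro p hp q hq
      have := hA.1 p.1 q.1 (p.2 + W y) (q.2 + W y) hp hq
      rwa [add_sub_add_right_eq_sub] at this
    · intro p hp
      refine hA.mem_of_forall_inner_nonneg fun z v hv => ?_
      have := hp (z, v - W y) (by simpa using hv)
      rwa [← sub_add, sub_add_eq_add_sub] at this
    · exact (metricClass.inverse_isPositive hα hU).smul_of_nonneg hγ'.le
    · exact (metricClass.isPositive hα hU).smul_of_nonneg hγ.le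
    · intro x
      simp only [hWdef, hZdef, smul_apply, map_smul, metricClass.inverse_apply_self hα hU]
      rw [smul_smul, mul_inv_cancel₀ hγ.ne', one_smul]
    · intro x
      refine (mul_le_mul_of_nonneg_right (min_le_left _ _) (sq_nonneg _)).trans ?_
      rw [hWdef, smul_apply, real_inner_smul_left, mul_assoc]
      refine mul_le_mul_of_nonneg_left ?_ hγ'.le
      rw [inv_mul_le_iff₀ hN]
      nlinarith [metricClass.norm_sq_le hα hU x,
        (metricClass.inverse_isPositive hα hU).inner_nonneg_left x]
    · intro x
      refine (mul_le_mul_of_nonneg_right (min_le_right _ _) (sq_nonneg _)).trans ?_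
      rw [hZdef, smul_apply, real_inner_smul_left, mul_assoc]
      exact mul_le_mul_of_nonneg_left (metricClass.le_inner hU x) hγ.le
  obtain ⟨p, hp⟩ := hG
  refine ⟨p, ?_⟩
  have : -W p + W y ∈ A p := hp
  rwa [neg_add_eq_sub, ← map_sub] at this

theorem IsMaximalMonotone.smul_inverse_sub_resolvent_mem [CompleteSpace H] {A : H → Set H}
    (hA : IsMaximalMonotone A) (hne : (gra A).Nonempty) {α γ : ℝ} (hα : 0 < α) (hγ : 0 < γ)
    {U : H →L[ℝ] H} (hU : U ∈ metricClass (H := H) α) (y : H) :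
    γ⁻¹ • U.inverse (y - resolvent (scaledOp γ U A) y) ∈ A (resolvent (scaledOp γ U A) y) := by
  have hmem : resolvent (scaledOp γ U A) y ∈ resolventSet (scaledOp γ U A) y := by
    refine Classical.epsilon_spec (p := fun p => p ∈ resolventSet (scaledOp γ U A) y) ?_
    obtain ⟨p, hp⟩ := hA.exists_smul_inverse_sub_mem hne hα hγ hU y
    refine ⟨p, Set.mem_add.2 ⟨p, rfl, _, ⟨_, hp, rfl⟩, ?_⟩⟩
    simp only [map_smul, metricClass.apply_inverse_self hα hU]
    rw [smul_smul, mul_inv_cancel₀ hγ.ne',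
      one_smul, add_sub_cancel]
  obtain ⟨_, rfl, _, ⟨u, hu, rfl⟩, h⟩ := Set.mem_add.1 hmem
  have h' : y - resolvent (scaledOp γ U A) y = γ • U u := by
    nth_rewrite 1 [← h]
    exact add_sub_cancel_left _ _
  rw [h', map_smul, metricClass.inverse_apply_self hα hU, smul_smul, inv_mul_cancel₀ hγ.ne',
    one_smul]
  exact hu

end VMFB

namespace VMFB

theorem mem_zer_addSingle {H : Type*} [NormedAddCommGroup H] {A : H → Set H} {B : H → H} {x : H} :
    x ∈ zer (addSingle A B) ↔ -B x ∈ A x := by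
  change (0 : H) ∈ A x + {B x} ↔ _
  rw [Set.mem_add]
  constructor
  · rintro ⟨u, hu, _, rfl, h⟩
    rwa [← eq_neg_of_add_eq_zero_left h]
  · exact fun h => ⟨_, h, _, rfl, neg_add_cancel _⟩

variable {H : Type*} [NormedAddCommGroup H] [InnerProductSpace ℝ H]

/-! ### Demiclosedness -/

theorem IsCocoercive.mul_norm_sub_le {B : H → H} {β : ℝ} (hB : IsCocoercive β B) (x y : H) :
    β * ‖B x - B y‖ ≤ ‖x - y‖ := by
  rcases (norm_nonneg (B x - B y)).eq_or_lt with h0 | h0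
  · rw [← h0]; simp
  · refine le_of_mul_le_mul_right ?_ h0
    have := (hB x y).trans (real_inner_le_norm _ _)
    linarith

/-- The graph of `A + B` is sequentially closed for the weak topology on the domain and the
norm topology on the range. -/
theorem IsMaximalMonotone.neg_mem_of_tendsto [CompleteSpace H] {A : H → Set H}
    (hA : IsMaximalMonotone A) {B : H → H} {β : ℝ} (hβ : 0 < β) (hB : IsCocoercive β B)
    {ι : Type*} {F : Filter ι} [F.NeBot] {p u : ι → H} {z : H} {R : ℝ} (hR : ∀ k, ‖p k‖ ≤ R)
    (hu : ∀ k, u k ∈ A (p k)) (hp : ∀ v, Tendsto (fun k => ⟪p k, v⟫_ℝ) F (𝓝 ⟪z, v⟫_ℝ))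
    (h0 : Tendsto (fun k => u k + B (p k)) F (𝓝 0)) : -B z ∈ A z := by
  have hne : (gra A).Nonempty := by
    obtain ⟨k⟩ := F.nonempty_of_neBot
    exact ⟨(p k, u k), hu k⟩
  have hγ : 0 < β / 2 := by positivity
  have hlim : ∀ v w, w ∈ A v → 0 ≤ ⟪z - v, -(w + B v)⟫_ℝ := by
    intro v w hw
    have h1 : Tendsto (fun k => ⟪p k, u k + B (p k)⟫_ℝ) F (𝓝 0) := by
      refine squeeze_zero_norm (fun k => (norm_inner_le_norm _ _).trans
        (mul_le_mul_of_nonneg_right (hR k) (norm_nonneg _))) ?_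
      simpa using h0.norm.const_mul R
    have h2 : Tendsto (fun k => ⟪v, u k + B (p k)⟫_ℝ) F (𝓝 ⟪v, 0⟫_ℝ) :=
      tendsto_const_nhds.inner h0
    have h3 := ((h1.sub h2).sub (hp (w + B v))).add_const ⟪v, w + B v⟫_ℝ
    have h4 : (0 : ℝ) - ⟪v, (0 : H)⟫_ℝ - ⟪z, w + B v⟫_ℝ + ⟪v, w + B v⟫_ℝ =
        ⟪z - v, -(w + B v)⟫_ℝ := by
      rw [inner_zero_right, inner_neg_right, inner_sub_left]
      ring
    rw [h4] at h3
    refine ge_of_tendsto' h3 fun k => ?_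
    have h5 := hA.1 _ _ _ _ (show (p k, u k) ∈ gra A from hu k) (show (v, w) ∈ gra A from hw)
    have h6 := hB (p k) v
    have h7 : 0 ≤ β * ‖B (p k) - B v‖ ^ 2 := by positivity
    simp only [inner_sub_left, inner_sub_right, inner_add_right] at h5 h6 ⊢
    linarith
  -- Test `hlim` at a forward-backward step `v` from `z`. As `B` is `1/β`-Lipschitz, step size `β /
  -- 2` yields `‖z - v‖² ≤ ‖z - v‖² / 2`, so `z = v` is a fixed point, that is, a zero.
  obtain ⟨v, hv⟩ := hA.exists_smul_inverse_sub_mem hne one_pos hγ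
    (smul_one_mem_metricClass (H := H) 1) (z - (β / 2) • B z)
  have hinv : ∀ y : H, ((1 : ℝ) • (1 : H →L[ℝ] H)).inverse y = y := fun y => by
    have := metricClass.inverse_apply_self one_pos (smul_one_mem_metricClass (H := H) 1) y
    simpa using this
  have hw : (β / 2)⁻¹ • (z - (β / 2) • B z - v) = (β / 2)⁻¹ • (z - v) - B z := by
    rw [sub_right_comm, smul_sub _ (z - v), smul_smul, inv_mul_cancel₀ hγ.ne', one_smul]
  rw [hinv, hw] at hv
  have h1 := hlim v _ hv
  have h2 : -((β / 2)⁻¹ • (z - v) - B z + B v) = (B z - B v) - (β / 2)⁻¹ • (z - v) := by abel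
  rw [h2, inner_sub_right, real_inner_smul_right, real_inner_self_eq_norm_sq] at h1
  have h3 := hB.mul_norm_sub_le z v
  have h4 := real_inner_le_norm (z - v) (B z - B v)
  have h5 : ‖z - v‖ ^ 2 ≤ 0 := by
    have h6 : (β / 2)⁻¹ * ‖z - v‖ ^ 2 ≤ ‖z - v‖ * ‖B z - B v‖ := by linarith
    rw [inv_mul_le_iff₀ hγ] at h6
    have h7 := mul_le_mul_of_nonneg_left h3 (norm_nonneg (z - v))
    linarith
  have h6 : z - v = 0 := by
    rw [← norm_eq_zero]
    exact pow_eq_zero_iff two_ne_zero |>.1 (le_antisymm h5 (sq_nonneg _))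
  have h7 : v = z := (sub_eq_zero.1 h6).symm
  rw [h6, smul_zero, zero_sub, h7] at hv
  exact hv

/-! ### Quasi-Fejér sequences in a variable metric -/

/-- Since `t ≤ s`, the recursion with summable errors makes `s` converge; `ν k` is then squeezed by
a perturbed difference of consecutive squares of `s`. -/
theorem exists_tendsto_and_tendsto_zero_of_quasiFejer {s t δ η ν : ℕ → ℝ} (hs : ∀ k, 0 ≤ s k)
    (ht : ∀ k, 0 ≤ t k) (hδ0 : ∀ k, 0 ≤ δ k) (hδ : Summable δ) (hη0 : ∀ k, 0 ≤ η k)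
    (hη : Summable η) (hν0 : ∀ k, 0 ≤ ν k) (h1 : ∀ k, t k ^ 2 ≤ s k ^ 2 - ν k)
    (h2 : ∀ k, s (k + 1) ^ 2 ≤ (1 + η k) * (t k + δ k) ^ 2) :
    (∃ l : ℝ, Tendsto s atTop (𝓝 l)) ∧ Tendsto ν atTop (𝓝 0) := by
  have hts : ∀ k, t k ≤ s k := fun k =>
    le_of_sq_le_sq (by linarith [h1 k, hν0 k]) (hs k)
  obtain ⟨l, hl⟩ := exists_tendsto_of_le_one_add_mul hs hδ0 hδ hη0 hη fun k => by
    have ha : 0 ≤ t k + δ k := add_nonneg (ht k) (hδ0 k)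
    have hb : t k + δ k ≤ s k + δ k := by linarith [hts k]
    refine le_of_sq_le_sq ((h2 k).trans ?_) (mul_nonneg (by linarith [hη0 k]) (ha.trans hb))
    rw [mul_pow]
    refine mul_le_mul ?_ (pow_le_pow_left₀ ha hb 2) (sq_nonneg _) (sq_nonneg _)
    nlinarith [hη0 k]
  refine ⟨⟨l, hl⟩, ?_⟩
  have hlim : Tendsto (fun k => (1 + η k) * (s k ^ 2 + 2 * s k * δ k + δ k ^ 2) - s (k + 1) ^ 2)
      atTop (𝓝 ((1 + 0) * (l ^ 2 + 2 * l * 0 + 0 ^ 2) - l ^ 2)) := by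
    have e1 := hη.tendsto_atTop_zero
    have e2 := hδ.tendsto_atTop_zero
    exact ((tendsto_const_nhds.add e1).mul
      (((hl.pow 2).add ((hl.const_mul 2).mul e2)).add (e2.pow 2))).sub
      ((hl.comp (tendsto_add_atTop_nat 1)).pow 2)
  have h0 : (1 + 0) * (l ^ 2 + 2 * l * 0 + 0 ^ 2) - l ^ 2 = 0 := by ring
  rw [h0] at hlim
  refine squeeze_zero hν0 (fun k => ?_) hlim
  have e1 : (t k + δ k) ^ 2 ≤ s k ^ 2 + 2 * s k * δ k + δ k ^ 2 - ν k := by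
    nlinarith [h1 k, mul_le_mul_of_nonneg_right (hts k) (hδ0 k)]
  have e2 := mul_le_mul_of_nonneg_left e1 (by linarith [hη0 k] : 0 ≤ 1 + η k)
  have e3 := mul_nonneg (hη0 k) (hν0 k)
  linarith [h2 k]

/-- Opial's argument in a variable metric. -/
theorem exists_weaklyConverges_of_fejer [CompleteSpace H] {V : ℕ → H →L[ℝ] H} {C M : ℝ}
    (hV : ∀ k, (V k).IsPositive) (hC : ∀ k, ‖V k‖ ≤ C)
    (hM : ∀ k x, ‖x‖ ^ 2 ≤ M * ⟪V k x, x⟫_ℝ) {η : ℕ → ℝ} (hη0 : ∀ k, 0 ≤ η k)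
    (hη : Summable η) (hanti : ∀ k x, ⟪V (k + 1) x, x⟫_ℝ ≤ (1 + η k) * ⟪V k x, x⟫_ℝ)
    {Ω : Set H} {x : ℕ → H} {R : ℝ} (hx : ∀ k, ‖x k‖ ≤ R)
    (hlim : ∀ z ∈ Ω, ∃ l : ℝ, Tendsto (fun k => opNorm (V k) (x k - z)) atTop (𝓝 l))
    (hcl : ∀ F : Ultrafilter ℕ, (F : Filter ℕ) ≤ atTop → ∀ z,
      (∀ v, Tendsto (fun k => ⟪x k, v⟫_ℝ) F (𝓝 ⟪z, v⟫_ℝ)) → z ∈ Ω) :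
    ∃ z ∈ Ω, WeaklyConverges x z := by
  obtain ⟨P, hP⟩ := exists_tendsto_prod_one_add hη0 hη
  set p : ℕ → ℝ := fun k => ∏ i ∈ Finset.range k, (1 + η i) with hp
  have hp1 : ∀ k, 1 ≤ p k := one_le_prod_one_add hη0
  have hpos : ∀ k, 0 < p k := fun k => one_pos.trans_le (hp1 k)
  have hsucc : ∀ k, p (k + 1) = p k * (1 + η k) := fun k => Finset.prod_range_succ _ _
  have hVlim : ∀ w, ∃ v, Tendsto (fun k => V k w) atTop (𝓝 v) := by
    intro w
    -- Dividing by the product of the `1 + η i` makes the metrics genuinely decreasing.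
    obtain ⟨v, hv⟩ := exists_tendsto_of_antitone_isPositive (W := fun k => (p k)⁻¹ • V k)
      (C := C) (fun k => (hV k).smul_of_nonneg (inv_nonneg.2 (hpos k).le)) (fun k => by
        rw [norm_smul, norm_inv, Real.norm_of_nonneg (hpos k).le]
        exact (mul_le_of_le_one_left (norm_nonneg _) (inv_le_one_of_one_le₀ (hp1 k))).trans
          (hC k)) (fun k z => by
        simp only [smul_apply, real_inner_smul_left]
        rw [hsucc, mul_inv, mul_assoc]
        refine mul_le_mul_of_nonneg_left ?_ (inv_nonneg.2 (hpos k).le)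
        rw [inv_mul_le_iff₀ (by linarith [hη0 k])]
        exact hanti k z) w
    refine ⟨P • v, (hP.smul hv).congr fun k => ?_⟩
    rw [smul_apply, smul_smul]
    exact (congrArg (· • V k w) (mul_inv_cancel₀ (hpos k).ne')).trans (one_smul _ _)
  have huniq : ∀ F G : Ultrafilter ℕ, (F : Filter ℕ) ≤ atTop → (G : Filter ℕ) ≤ atTop →
      ∀ z z', (∀ v, Tendsto (fun k => ⟪x k, v⟫_ℝ) F (𝓝 ⟪z, v⟫_ℝ)) →
      (∀ v, Tendsto (fun k => ⟪x k, v⟫_ℝ) G (𝓝 ⟪z', v⟫_ℝ)) → z = z' := by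
    intro F G hF hG z z' hz hz'
    obtain ⟨l, hl⟩ := hlim z (hcl F hF z hz)
    obtain ⟨l', hl'⟩ := hlim z' (hcl G hG z' hz')
    obtain ⟨a, ha⟩ := hVlim z
    obtain ⟨a', ha'⟩ := hVlim z'
    -- Polarization: the difference of the two squared distances is affine in `x k`. Boundedness
    -- then allows replacing `V k (z - z')` by its limit `a - a'`, so both cluster points have the
    -- same product with `a - a'`.
    have hxV : Tendsto (fun k => ⟪x k, V k (z - z')⟫_ℝ) atTop
        (𝓝 ((l' ^ 2 - l ^ 2 + ⟪a, z⟫_ℝ - ⟪a', z'⟫_ℝ) / 2)) := by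
      have h1 := ((((hl'.pow 2).sub (hl.pow 2)).add (ha.inner (tendsto_const_nhds (x := z)))).sub
        (ha'.inner (tendsto_const_nhds (x := z')))).div_const 2
      refine h1.congr fun k => ?_
      rw [opNorm_sq (hV k), opNorm_sq (hV k)]
      simp only [map_sub, inner_sub_left, inner_sub_right,
        inner_map_comm_of_isPositive (hV k) (x k), real_inner_comm (V k z) (x k),
        real_inner_comm (V k z') (x k)]
      ring
    have hv := ha.sub ha'
    have herr : Tendsto (fun k => ⟪x k, (V k z - V k z') - (a - a')⟫_ℝ) atTop (𝓝 0) := by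
      refine squeeze_zero_norm (fun k => (norm_inner_le_norm _ _).trans
        (mul_le_mul_of_nonneg_right (hx k) (norm_nonneg _))) ?_
      have := (tendsto_sub_nhds_zero_iff.2 hv).norm.const_mul R
      simpa using this
    have hxv := hxV.sub herr
    simp only [← map_sub, ← inner_sub_right, sub_sub_cancel, sub_zero] at hxv
    have e1 := tendsto_nhds_unique (hz (a - a')) (hxv.mono_left hF)
    have e2 := tendsto_nhds_unique (hz' (a - a')) (hxv.mono_left hG)
    have e3 : ⟪a - a', z - z'⟫_ℝ = 0 := by
      rw [real_inner_comm, inner_sub_left, e1, e2, sub_self]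
    have hlow : ‖z - z'‖ ^ 2 ≤ M * ⟪a - a', z - z'⟫_ℝ := by
      refine ge_of_tendsto' ((hv.inner (tendsto_const_nhds (x := z - z'))).const_mul M)
        fun k => ?_
      rw [← map_sub]
      exact hM k _
    rw [e3, mul_zero] at hlow
    have : ‖z - z'‖ = 0 :=
      pow_eq_zero_iff two_ne_zero |>.1 (le_antisymm hlow (sq_nonneg _))
    exact sub_eq_zero.1 (norm_eq_zero.1 this)
  obtain ⟨z, hz⟩ := exists_forall_tendsto_inner_of_bounded (Ultrafilter.of atTop) hx
  refine ⟨z, hcl _ (Ultrafilter.of_le _) z hz, weaklyConverges_of_tendsto_inner fun v => ?_⟩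
  refine (tendsto_iff_ultrafilter _ _ _).2 fun G hG => ?_
  obtain ⟨z', hz'⟩ := exists_forall_tendsto_inner_of_bounded G hx
  rw [huniq _ G (Ultrafilter.of_le _) hG z z' hz hz']
  exact hz' v

/-! ### One forward-backward step -/

section Step

theorem one_div_avgConst (hβ : 0 < β) (γ : ℝ) (U : H →L[ℝ] H) :
    1 / avgConst β γ U = 2 - γ * ‖U‖ / (2 * β) := by
  rw [avgConst, one_div_div]
  field_simp
  ring

variable [CompleteSpace H] {A : H → Set H} {B : H → H} {α β γ : ℝ} {U : H →L[ℝ] H}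

theorem IsMonotoneOp.opNorm_sub_le_of_mem (hA : IsMonotoneOp A) (hα : 0 < α) (hγ : 0 < γ)
    (hU : U ∈ metricClass (H := H) α) {y y' p p' : H} (hp : γ⁻¹ • U.inverse (y - p) ∈ A p)
    (hp' : γ⁻¹ • U.inverse (y' - p') ∈ A p') :
    opNorm U.inverse (p - p') ≤ opNorm U.inverse (y - y') := by
  have hV := metricClass.inverse_isPositive hα hU
  have h := hA _ _ _ _ (show (p, _) ∈ gra A from hp) (show (p', _) ∈ gra A from hp')
  rw [← smul_sub, real_inner_smul_right] at h
  have h1 := nonneg_of_mul_nonneg_right h (inv_pos.2 hγ)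
  have h2 : U.inverse (y - p) - U.inverse (y' - p') =
      U.inverse (y - y') - U.inverse (p - p') := by
    simp only [map_sub]
    abel
  rw [h2, inner_sub_right, real_inner_comm, real_inner_comm (U.inverse (p - p')),
    ← opNorm_sq hV] at h1
  have h3 := inner_map_le_opNorm_mul hV (y - y') (p - p')
  rcases (opNorm_nonneg U.inverse (p - p')).eq_or_lt with h0 | h0
  · rw [← h0]
    exact opNorm_nonneg _ _
  · refine le_of_mul_le_mul_right ?_ h0
    linarith

/-- Monotonicity of `A` between `p` and `xs`, cocoercivity of `B` between `x` and `xs`, and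
polarization in the metric `U⁻¹`. -/
theorem IsMonotoneOp.opNorm_sq_forwardBackward_le (hA : IsMonotoneOp A)
    (hB : IsCocoercive β B) (hα : 0 < α) (hγ : 0 < γ) (hU : U ∈ metricClass (H := H) α)
    {x p xs : H} (hp : γ⁻¹ • U.inverse (x - γ • U (B x) - p) ∈ A p) (hxs : -B xs ∈ A xs) :
    opNorm U.inverse (p - xs) ^ 2 ≤ opNorm U.inverse (x - xs) ^ 2 - opNorm U.inverse (x - p) ^ 2
      - 2 * γ * β * ‖B x - B xs‖ ^ 2 + 2 * γ * ⟪B x - B xs, x - p⟫_ℝ := by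
  have hV := metricClass.inverse_isPositive hα hU
  have hu : γ⁻¹ • U.inverse (x - γ • U (B x) - p) = γ⁻¹ • U.inverse (x - p) - B x := by
    rw [sub_right_comm, map_sub, map_smul, metricClass.inverse_apply_self hα hU, smul_sub,
      smul_smul, inv_mul_cancel₀ hγ.ne', one_smul]
  rw [hu] at hp
  have h := hA _ _ _ _ (show (p, _) ∈ gra A from hp) (show (xs, _) ∈ gra A from hxs)
  have h1 : γ⁻¹ • U.inverse (x - p) - B x - -B xs =
      γ⁻¹ • U.inverse (x - p) - (B x - B xs) := by abel
  rw [h1, inner_sub_right, real_inner_smul_right] at h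
  have h2 : γ * ⟪p - xs, B x - B xs⟫_ℝ ≤ ⟪p - xs, U.inverse (x - p)⟫_ℝ := by
    rw [← le_inv_mul_iff₀ hγ]
    linarith
  have hc := mul_le_mul_of_nonneg_left (hB x xs) hγ.le
  have e1 : ⟪p - xs, B x - B xs⟫_ℝ = ⟪x - xs, B x - B xs⟫_ℝ - ⟪B x - B xs, x - p⟫_ℝ := by
    rw [real_inner_comm (x - p), ← inner_sub_left, sub_sub_sub_cancel_left]
  have e2 : 2 * ⟪p - xs, U.inverse (x - p)⟫_ℝ = opNorm U.inverse (x - xs) ^ 2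
      - opNorm U.inverse (p - xs) ^ 2 - opNorm U.inverse (x - p) ^ 2 := by
    have e3 : x - xs = (x - p) + (p - xs) := by abel
    rw [e3, opNorm_sq hV, opNorm_sq hV, opNorm_sq hV]
    generalize x - p = r
    generalize p - xs = d
    rw [map_add, inner_add_left, inner_add_right, inner_add_right,
      inner_map_comm_of_isPositive hV d r, real_inner_comm d (U.inverse r)]
    ring
  rw [e1] at h2
  linarith

theorem IsMonotoneOp.opNorm_sq_relaxed_le (hA : IsMonotoneOp A) (hβ : 0 < β)
    (hB : IsCocoercive β B) (hα : 0 < α) (hγ : 0 < γ) (hU : U ∈ metricClass (H := H) α)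
    {x p xs : H} (hp : γ⁻¹ • U.inverse (x - γ • U (B x) - p) ∈ A p) (hxs : -B xs ∈ A xs)
    {c : ℝ} (hc : 0 ≤ c) :
    opNorm U.inverse (x + c • (p - x) - xs) ^ 2 ≤ opNorm U.inverse (x - xs) ^ 2
      - c * (1 / avgConst β γ U - c) * opNorm U.inverse (x - p) ^ 2 := by
  have hV := metricClass.inverse_isPositive hα hU
  have h1 := hA.opNorm_sq_forwardBackward_le hB hα hγ hU hp hxs
  have h2 := metricClass.norm_sq_le hα hU (x - p)
  rw [← opNorm_sq hV] at h2
  have h3 : 2 * γ * ⟪B x - B xs, x - p⟫_ℝ ≤ 2 * γ * β * ‖B x - B xs‖ ^ 2 +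
      γ * ‖U‖ / (2 * β) * opNorm U.inverse (x - p) ^ 2 := by
    have e1 := real_inner_le_norm (B x - B xs) (x - p)
    have e2 : 2 * (‖B x - B xs‖ * ‖x - p‖) ≤ 2 * β * ‖B x - B xs‖ ^ 2 +
        ‖x - p‖ ^ 2 / (2 * β) := by
      have e3 : 2 * β * ‖B x - B xs‖ ^ 2 + ‖x - p‖ ^ 2 / (2 * β) -
          2 * (‖B x - B xs‖ * ‖x - p‖) = (2 * β * ‖B x - B xs‖ - ‖x - p‖) ^ 2 / (2 * β) := by
        field_simp
        ring
      have e4 : 0 ≤ (2 * β * ‖B x - B xs‖ - ‖x - p‖) ^ 2 / (2 * β) := by positivity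
      linarith
    have e5 : ‖x - p‖ ^ 2 / (2 * β) ≤ ‖U‖ * opNorm U.inverse (x - p) ^ 2 / (2 * β) := by gcongr
    calc 2 * γ * ⟪B x - B xs, x - p⟫_ℝ
        ≤ γ * (2 * β * ‖B x - B xs‖ ^ 2 + ‖U‖ * opNorm U.inverse (x - p) ^ 2 / (2 * β)) := by
          rw [mul_comm 2 γ, mul_assoc]
          refine mul_le_mul_of_nonneg_left ?_ hγ.le
          linarith
      _ = _ := by ring
  have h4 : opNorm U.inverse (p - xs) ^ 2 ≤ opNorm U.inverse (x - xs) ^ 2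
      - (1 - γ * ‖U‖ / (2 * β)) * opNorm U.inverse (x - p) ^ 2 := by linarith
  -- The identity for the squared norm of an affine combination of `x - xs` and `p - xs`.
  have h5 : opNorm U.inverse (x + c • (p - x) - xs) ^ 2 =
      (1 - c) * opNorm U.inverse (x - xs) ^ 2 + c * opNorm U.inverse (p - xs) ^ 2
      - c * (1 - c) * opNorm U.inverse (x - p) ^ 2 := by
    have e1 : x + c • (p - x) - xs = (1 - c) • (x - xs) + c • (p - xs) := by module
    have e2 : x - p = (x - xs) - (p - xs) := by abel
    rw [e1, e2, opNorm_sq hV, opNorm_sq hV, opNorm_sq hV, opNorm_sq hV]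
    generalize x - xs = e
    generalize p - xs = d
    simp only [map_add, map_sub, map_smul, inner_add_left, inner_add_right, inner_sub_left,
      inner_sub_right, real_inner_smul_left, real_inner_smul_right,
      inner_map_comm_of_isPositive hV d e]
    ring
  rw [h5, one_div_avgConst hβ]
  linarith [mul_le_mul_of_nonneg_left h4 hc]

theorem opNorm_inverse_smul_apply_le (hα : 0 < α) (hγ : 0 < γ) (hγU : γ * ‖U‖ ≤ 2 * β)
    (hU : U ∈ metricClass (H := H) α) (b : H) :
    opNorm U.inverse (γ • U b) ≤ 2 * β * ‖b‖ / √α := by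
  refine (metricClass.opNorm_inverse_le hα hU _).trans ?_
  gcongr
  rw [norm_smul, Real.norm_of_nonneg hγ.le]
  calc γ * ‖U b‖ ≤ γ * (‖U‖ * ‖b‖) := by gcongr; exact U.le_opNorm b
    _ = γ * ‖U‖ * ‖b‖ := by ring
    _ ≤ _ := by gcongr

end Step

end VMFB

/-! ### Convergence of the inexact variable metric iteration. -/

theorem theorem3p1 {H : Type*} [NormedAddCommGroup H] [InnerProductSpace ℝ H] [CompleteSpace H]
    (A : H → Set H) (hA : VMFB.IsMaximalMonotone A)
    (B : H → H) (β : ℝ) (hβ : 0 < β) (hB : VMFB.IsCocoercive β B)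
    (hΩ : (VMFB.zer (VMFB.addSingle A B)).Nonempty)
    (α : ℝ) (hα : 0 < α)
    (η : ℕ → ℝ) (hη0 : ∀ k, 0 ≤ η k) (hη : Summable η)
    (U : ℕ → H →L[ℝ] H) (hU : ∀ k, U k ∈ VMFB.metricClass α)
    (μ : ℝ) (hμ : IsLUB (Set.range fun k => ‖U k‖) μ)
    (hUmono : ∀ k, U k ≤ (1 + η k) • U (k + 1))
    (γ : ℕ → ℝ) (hγ0 : ∀ k, 0 < γ k) (hγ : ∀ k, γ k * ‖U k‖ < 2 * β)
    (lam : ℕ → ℝ) (hlam0 : ∀ k, 0 < lam k)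
    (hlam : ∀ k, lam k < 1 / VMFB.avgConst β (γ k) (U k))
    (a b : ℕ → H) (ha : Summable fun k => lam k * ‖a k‖) (hb : Summable fun k => lam k * ‖b k‖)
    (x y : ℕ → H)
    (hy : ∀ k, y k = x k - γ k • U k (B (x k) + b k))
    (hx : ∀ k, x (k + 1) =
      x k + lam k • (VMFB.resolvent (VMFB.scaledOp (γ k) (U k) A) (y k) + a k - x k)) :
    (∀ xs ∈ VMFB.zer (VMFB.addSingle A B),
      ∃ l : ℝ, Tendsto (fun k => VMFB.opNorm (U k).inverse (x k - xs)) atTop (𝓝 l)) ∧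
    ∀ lamLow τ : ℝ, 0 < lamLow → 0 < τ →
      (∀ k, τ < 1 / VMFB.avgConst β (γ k) (U k) - lamLow) →
      (∀ k, lamLow ≤ lam k) → (∀ k, lam k ≤ 1 / VMFB.avgConst β (γ k) (U k) - τ) →
      Tendsto (fun k => ‖x k - VMFB.resolvent (VMFB.scaledOp (γ k) (U k) A)
          (x k - γ k • U k (B (x k)))‖) atTop (𝓝 0) ∧
      ∀ γLow : ℝ, 0 < γLow → (∀ k, γLow ≤ γ k) →
        (∃ z ∈ VMFB.zer (VMFB.addSingle A B), VMFB.WeaklyConverges x z) ∧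
        ∀ ε : ℝ, 0 < ε → ε < 2 * β - μ * γLow → (∀ k, γ k * μ ≤ 2 * β - ε) →
          ∀ xs ∈ VMFB.zer (VMFB.addSingle A B),
            Tendsto (fun k => B (x k)) atTop (𝓝 (B xs)) := by
  
  have hV := fun k => VMFB.metricClass.inverse_isPositive hα (hU k)
  have hne : (VMFB.gra A).Nonempty := by
    obtain ⟨z, hz⟩ := hΩ
    exact ⟨(z, -B z), VMFB.mem_zer_addSingle.1 hz⟩
  have hη1 : ∀ k, 0 < 1 + η k := fun k => by linarith [hη0 k]
  have hres : ∀ k w, (γ k)⁻¹ • (U k).inverse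
      (w - VMFB.resolvent (VMFB.scaledOp (γ k) (U k) A) w) ∈
        A (VMFB.resolvent (VMFB.scaledOp (γ k) (U k) A) w) := fun k w =>
    hA.smul_inverse_sub_resolvent_mem hne hα (hγ0 k) (hU k) w
  set p : ℕ → H := fun k => VMFB.resolvent (VMFB.scaledOp (γ k) (U k) A)
    (x k - γ k • U k (B (x k))) with hpdef
  have hp : ∀ k, (γ k)⁻¹ • (U k).inverse (x k - γ k • U k (B (x k)) - p k) ∈ A (p k) :=
    fun k => hres k _
  -- `1/√α` compares the `U_k⁻¹`-norm with the original one; `2β` bounds `γ_k ‖U_k‖`, the size of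
  -- the forward error.
  set δ : ℕ → ℝ := fun k => (lam k * ‖a k‖ + 2 * β * (lam k * ‖b k‖)) / √α with hδdef
  have hδ0 : ∀ k, 0 ≤ δ k := fun k => by
    have := (hlam0 k).le
    positivity
  have hδ : Summable δ := (ha.add (hb.mul_left (2 * β))).div_const _
  have hanti : ∀ k z, ⟪(U (k + 1)).inverse z, z⟫_ℝ ≤ (1 + η k) * ⟪(U k).inverse z, z⟫_ℝ :=
    fun k z => VMFB.metricClass.inner_inverse_le_of_le hα (hη1 k) (hU k) (hU (k + 1)) (hUmono k) z
  set ν : ℕ → ℝ := fun k => lam k * (1 / VMFB.avgConst β (γ k) (U k) - lam k) *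
    VMFB.opNorm (U k).inverse (x k - p k) ^ 2 with hνdef
  have herr : ∀ k xs, VMFB.opNorm (U k).inverse (x (k + 1) - xs) ≤
      VMFB.opNorm (U k).inverse (x k + lam k • (p k - x k) - xs) + δ k := by
    intro k xs
    set q := VMFB.resolvent (VMFB.scaledOp (γ k) (U k) A) (y k) with hq
    have e1 : x (k + 1) - xs = (x k + lam k • (p k - x k) - xs) + lam k • ((q - p k) + a k) := by
      rw [hx k]
      module
    rw [e1]
    refine (VMFB.opNorm_add_le (hV k) _ _).trans (add_le_add_right ?_ _)
    rw [VMFB.opNorm_smul (hlam0 k).le]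
    have e2 := hA.1.opNorm_sub_le_of_mem hα (hγ0 k) (hU k) (hp k) (hres k (y k))
    have e3 : x k - γ k • U k (B (x k)) - y k = γ k • U k (b k) := by
      rw [hy k, map_add]
      module
    rw [e3] at e2
    have e4 := VMFB.opNorm_inverse_smul_apply_le hα (hγ0 k) (hγ k).le (hU k) (b k)
    have e5 := VMFB.metricClass.opNorm_inverse_le hα (hU k) (a k)
    have e6 : VMFB.opNorm (U k).inverse (q - p k) = VMFB.opNorm (U k).inverse (p k - q) := by
      rw [← neg_sub, VMFB.opNorm, VMFB.opNorm, map_neg, inner_neg_neg]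
    have e7 := VMFB.opNorm_add_le (hV k) (q - p k) (a k)
    have e8 : δ k = lam k * (2 * β * ‖b k‖ / √α + ‖a k‖ / √α) := by
      rw [hδdef]
      ring
    rw [e8]
    exact mul_le_mul_of_nonneg_left (by linarith) (hlam0 k).le
  have hfejer : ∀ xs ∈ VMFB.zer (VMFB.addSingle A B),
      (∃ l : ℝ, Tendsto (fun k => VMFB.opNorm (U k).inverse (x k - xs)) atTop (𝓝 l)) ∧
        Tendsto ν atTop (𝓝 0) := by
    intro xs hxs
    refine VMFB.exists_tendsto_and_tendsto_zero_of_quasiFejer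
      (t := fun k => VMFB.opNorm (U k).inverse (x k + lam k • (p k - x k) - xs))
      (fun k => VMFB.opNorm_nonneg _ _) (fun k => VMFB.opNorm_nonneg _ _) hδ0 hδ hη0 hη
      (fun k => ?_) (fun k => ?_) (fun k => ?_)
    · exact mul_nonneg (mul_nonneg (hlam0 k).le (sub_nonneg.2 (hlam k).le)) (sq_nonneg _)
    · exact hA.1.opNorm_sq_relaxed_le hβ hB hα (hγ0 k) (hU k) (hp k)
        (VMFB.mem_zer_addSingle.1 hxs) (hlam0 k).le
    · rw [VMFB.opNorm_sq (hV (k + 1))]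
      refine (hanti k _).trans (mul_le_mul_of_nonneg_left ?_ (hη1 k).le)
      rw [← VMFB.opNorm_sq (hV k)]
      exact pow_le_pow_left₀ (VMFB.opNorm_nonneg _ _) (herr k xs) 2
  refine ⟨fun xs hxs => (hfejer xs hxs).1, ?_⟩
  intro lamLow τ hlow hτ _ hlam1 hlam2
  obtain ⟨z₀, hz₀⟩ := hΩ
  have hUμ : ∀ k, ‖U k‖ ≤ μ := fun k => hμ.1 ⟨k, rfl⟩
  have hM : ∀ k z, ‖z‖ ^ 2 ≤ μ * ⟪(U k).inverse z, z⟫_ℝ := fun k z =>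
    (VMFB.metricClass.norm_sq_le hα (hU k) z).trans
      (mul_le_mul_of_nonneg_right (hUμ k) ((hV k).inner_nonneg_left z))
  have hμ0 : 0 ≤ μ := (norm_nonneg _).trans (hUμ 0)
  have hr : Tendsto (fun k => ‖x k - p k‖) atTop (𝓝 0) := by
    have h1 : Tendsto (fun k => ‖x k - p k‖ ^ 2) atTop (𝓝 0) := by
      refine squeeze_zero (fun k => sq_nonneg _) (fun k => ?_)
        -- `lamLow * τ` bounds `λ_k(1/α_k - λ_k)` from below, and `μ` compares the norms.
        (by simpa using (hfejer z₀ hz₀).2.const_mul (μ / (lamLow * τ)))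
      refine (hM k _).trans ?_
      rw [← VMFB.opNorm_sq (hV k), div_mul_eq_mul_div, le_div_iff₀ (by positivity), mul_assoc]
      refine mul_le_mul_of_nonneg_left ?_ hμ0
      rw [mul_comm]
      refine mul_le_mul_of_nonneg_right ?_ (sq_nonneg _)
      exact mul_le_mul (hlam1 k) (by linarith [hlam2 k]) hτ.le (hlam0 k).le
    have h2 := h1.sqrt
    simpa using h2
  refine ⟨hr, ?_⟩
  intro γLow hγLow hγ1
  have hbd : ∀ xs ∈ VMFB.zer (VMFB.addSingle A B), ∃ R, ∀ k, ‖x k - xs‖ ≤ R := by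
    intro xs hxs
    obtain ⟨l, hl⟩ := (hfejer xs hxs).1
    obtain ⟨R, hR⟩ := (hl.pow 2).bddAbove_range
    refine ⟨√(μ * R), fun k => Real.le_sqrt_of_sq_le ((hM k _).trans ?_)⟩
    rw [← VMFB.opNorm_sq (hV k)]
    exact mul_le_mul_of_nonneg_left (hR ⟨k, rfl⟩) hμ0
  have hr0 : Tendsto (fun k => x k - p k) atTop (𝓝 0) := tendsto_zero_iff_norm_tendsto_zero.2 hr
  have hVr : Tendsto (fun k => (γ k)⁻¹ • (U k).inverse (x k - p k)) atTop (𝓝 0) := by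
    refine squeeze_zero_norm (fun k => ?_) (by simpa using hr.const_mul (γLow⁻¹ * α⁻¹))
    rw [norm_smul, norm_inv, Real.norm_of_nonneg (hγ0 k).le, mul_assoc]
    refine mul_le_mul (inv_anti₀ hγLow (hγ1 k)) ?_ (norm_nonneg _) (by positivity)
    rw [le_inv_mul_iff₀ hα]
    exact VMFB.metricClass.norm_inverse_le hα (hU k) _
  constructor
  · obtain ⟨R, hR⟩ := hbd z₀ hz₀
    have hxR : ∀ k, ‖x k‖ ≤ R + ‖z₀‖ := fun k => by
      have := norm_le_norm_sub_add (x k) z₀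
      linarith [hR k]
    obtain ⟨R', hR'⟩ := hr.bddAbove_range
    have hpR : ∀ k, ‖p k‖ ≤ R' + (R + ‖z₀‖) := fun k => by
      have h1 := norm_le_norm_sub_add (p k) (x k)
      have h2 : ‖x k - p k‖ ≤ R' := hR' ⟨k, rfl⟩
      rw [norm_sub_rev] at h2
      linarith [hxR k]
    refine VMFB.exists_weaklyConverges_of_fejer (C := α⁻¹) hV (fun k => ?_) hM hη0 hη hanti hxR
      (fun z hz => (hfejer z hz).1) fun F hF z hz => ?_
    · refine ContinuousLinearMap.opNorm_le_bound _ (inv_nonneg.2 hα.le) fun z => ?_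
      rw [le_inv_mul_iff₀ hα]
      exact VMFB.metricClass.norm_inverse_le hα (hU k) z
    · refine VMFB.mem_zer_addSingle.2 (hA.neg_mem_of_tendsto hβ hB (F := F) hpR hp
        (fun v => ?_) ?_)
      · have h1 := (hz v).sub ((hr0.inner (tendsto_const_nhds (x := v))).mono_left hF)
        simpa only [← inner_sub_left, sub_sub_cancel, inner_zero_left, sub_zero] using h1
      · refine Tendsto.mono_left ?_ hF
        have h1 : Tendsto (fun k => B (p k) - B (x k)) atTop (𝓝 0) := by
          refine squeeze_zero_norm (fun k => ?_) (by simpa using hr.const_mul β⁻¹)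
          rw [le_inv_mul_iff₀ hβ, norm_sub_rev (x k)]
          exact hB.mul_norm_sub_le _ _
        have h2 := hVr.add h1
        rw [add_zero] at h2
        refine h2.congr fun k => ?_
        rw [sub_right_comm, map_sub _ (x k - p k), map_smul,
          VMFB.metricClass.inverse_apply_self hα (hU k), smul_sub, smul_smul,
          inv_mul_cancel₀ (hγ0 k).ne', one_smul]
        abel
  · intro _ _ _ _ xs hxs
    obtain ⟨R, hR⟩ := hbd xs hxs
    have hR0 : 0 ≤ R := (norm_nonneg _).trans (hR 0)
    have hDR : ∀ k, ‖B (x k) - B xs‖ ≤ β⁻¹ * R := fun k => by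
      rw [le_inv_mul_iff₀ hβ]
      exact (hB.mul_norm_sub_le _ _).trans (hR k)
    -- The forward-backward inequality divided by `2 β γ_k`; every term on the right contains the
    -- vanishing `x k - p k`.
    have key : ∀ k, ‖B (x k) - B xs‖ ^ 2 ≤
        (2 * β)⁻¹ * (2 * (‖(γ k)⁻¹ • (U k).inverse (x k - p k)‖ * R) +
          2 * (β⁻¹ * R * ‖x k - p k‖)) := by
      intro k
      have h1 := hA.1.opNorm_sq_forwardBackward_le hB hα (hγ0 k) (hU k) (hp k)
        (VMFB.mem_zer_addSingle.1 hxs)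
      have h2 : VMFB.opNorm (U k).inverse (x k - xs) ^ 2 -
          VMFB.opNorm (U k).inverse (p k - xs) ^ 2 ≤
          2 * ⟪(U k).inverse (x k - p k), x k - xs⟫_ℝ := by
        have h3 := (hV k).inner_nonneg_left (x k - p k)
        have h4 : p k - xs = (x k - xs) - (x k - p k) := by abel
        rw [h4, VMFB.opNorm_sq (hV k), VMFB.opNorm_sq (hV k)]
        clear h4 h1
        generalize x k - xs = e
        generalize x k - p k = r at h3 ⊢
        rw [map_sub, inner_sub_left, inner_sub_right, inner_sub_right,
          VMFB.inner_map_comm_of_isPositive (hV k) e r]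
        linarith
      have h5 := sq_nonneg (VMFB.opNorm (U k).inverse (x k - p k))
      have h6 : ⟪(U k).inverse (x k - p k), x k - xs⟫_ℝ ≤
          γ k * (‖(γ k)⁻¹ • (U k).inverse (x k - p k)‖ * R) := by
        rw [← inv_mul_le_iff₀ (hγ0 k), ← real_inner_smul_left]
        exact (real_inner_le_norm _ _).trans
          (mul_le_mul_of_nonneg_left (hR k) (norm_nonneg _))
      have h7 : γ k * ⟪B (x k) - B xs, x k - p k⟫_ℝ ≤ γ k * (β⁻¹ * R * ‖x k - p k‖) :=
        mul_le_mul_of_nonneg_left ((real_inner_le_norm _ _).trans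
          (mul_le_mul_of_nonneg_right (hDR k) (norm_nonneg _))) (hγ0 k).le
      rw [le_inv_mul_iff₀ (by positivity)]
      refine le_of_mul_le_mul_left ?_ (hγ0 k)
      linarith
    have hlim : Tendsto (fun k => ‖B (x k) - B xs‖ ^ 2) atTop (𝓝 0) := by
      refine squeeze_zero (fun k => sq_nonneg _) key ?_
      simpa using (((hVr.norm.mul_const R).const_mul 2).add
        ((hr.const_mul (β⁻¹ * R)).const_mul 2)).const_mul (2 * β)⁻¹
    rw [tendsto_iff_norm_sub_tendsto_zero]
    simpa using hlim.sqrt
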